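/- Let $d\ge 2$, let $\Omega\subset\mathbb{R}^d$ be a bounded open set, and equip $H^1_0(\Omega)$ (the closure of $C^\infty_c(\Omega)$ in $H^1(\Omega)$) with the norm $\|u\|_{H^1(\Omega)}=(\|u\|_{L^2(\Omega)}^2+\|\nabla u\|_{L^2(\Omega)}^2)^{1/2}$. Let $H^{-1}(\Omega)$ be its dual with the dual norm. There is a constant $C_\Omega>0$, depending only on $\Omega$, such that the following holds. Let $b\in (L^\infty(\Omega))^d$ and let $\sigma_h\in H^1(\Omega)$ be such that $\inf_\Omega\sigma_h>0$ (essential infimum) and such that $\sigma_h v\in H^1_0(\Omega)$ for every $v\in H^1_0(\Omega)$. Set $B_h=\nabla\sigma_h+\sigma_h b$ and, for $u,v\in H^1_0(\Omega)$, $$a_{\rm ss}(\sigma_h;u,v)=\int_\Omega \sigma_h\nabla u\cdot\nabla v+B_h\cdot\frac{(\nabla u)\,v-(\nabla v)\,u}{2}.$$ 1. For all $u,v\in H^1_0(\Omega)$ this integral converges absolutely, and $a_{\rm ss}(\sigma_h;\cdot,\cdot)$ is a bounded bilinear form on $H^1_0(\Omega)$. 2. This form is coercive: for all $u\in H^1_0(\Omega)$,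 $$a_{\rm ss}(\sigma_h;u,u)\ \ge\ C_\Omega\,\Big(\inf_\Omega\sigma_h\Big)\,\|u\|_{H^1(\Omega)}^2 .$$ 3. The discrete problem is well-posed, uniformly with respect to the discretization space (in particular, uniformly in the mesh size $H$): there is a constant $M$, depending neither on $U_H$ nor on $F$, such that for every closed (for instance, finite-dimensional) subspace $U_H\subset H^1_0(\Omega)$ and every $F\in H^{-1}(\Omega)$ there is exactly one $u_H\in U_H$ with $$a_{\rm ss}(\sigma_h;u_H,v_H)=F(\sigma_h v_H)\qquad\text{for all } v_H\in U_H,$$ and it satisfies $\|u_H\|_{H^1(\Omega)}\le M\,\|F\|_{H^{-1}(\Omega)}$. -/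

import Mathlib

open MeasureTheory TopologicalSpace Distributions

noncomputable section

namespace SkewGalerkin

variable {d : ℕ}

/-- The ambient Hilbert space `L²(Ω) × L²(Ω)^d`, with norm `(‖u‖² + ‖g‖²)^(1/2)`. -/
abbrev L2Pair (Ω : Opens (EuclideanSpace ℝ (Fin d))) : Type :=
  WithLp 2 (Lp ℝ 2 (volume.restrict (Ω : Set (EuclideanSpace ℝ (Fin d)))) ×
    Lp (EuclideanSpace ℝ (Fin d)) 2 (volume.restrict (Ω : Set (EuclideanSpace ℝ (Fin d)))))

/-- `g` is the weak gradient of `u` on `Ω`: for every smooth `φ` compactly supported in `Ω` and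
every `i`, `∫ u ∂ᵢφ = - ∫ gᵢ φ`. -/
def IsWeakGradient (Ω : Opens (EuclideanSpace ℝ (Fin d)))
    (u : EuclideanSpace ℝ (Fin d) → ℝ)
    (g : EuclideanSpace ℝ (Fin d) → EuclideanSpace ℝ (Fin d)) : Prop :=
  ∀ (φ : 𝓓(Ω, ℝ)) (i : Fin d),
    ∫ x in (Ω : Set (EuclideanSpace ℝ (Fin d))), u x * fderiv ℝ φ x (EuclideanSpace.single i 1) =
      -∫ x in (Ω : Set (EuclideanSpace ℝ (Fin d))), g x i * φ x

/-- A product of an `L²` function with a bounded continuous function is integrable on `Ω`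
when the latter is compactly supported. -/
lemma integrable_mul_of_compactSupport (Ω : Opens (EuclideanSpace ℝ (Fin d)))
    {f : EuclideanSpace ℝ (Fin d) → ℝ}
    (hf : MemLp f 2 (volume.restrict (Ω : Set (EuclideanSpace ℝ (Fin d)))))
    {ψ : EuclideanSpace ℝ (Fin d) → ℝ} (hc : Continuous ψ) (hs : HasCompactSupport ψ) :
    Integrable (fun x => f x * ψ x)
      (volume.restrict (Ω : Set (EuclideanSpace ℝ (Fin d)))) := by
  have h2 : MemLp ψ 2 (volume.restrict (Ω : Set (EuclideanSpace ℝ (Fin d)))) :=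
    (hc.memLp_of_hasCompactSupport hs).restrict _
  exact hf.integrable_mul h2

lemma continuous_partial (Ω : Opens (EuclideanSpace ℝ (Fin d))) (φ : 𝓓(Ω, ℝ))
    (e : EuclideanSpace ℝ (Fin d)) : Continuous (fun x => fderiv ℝ φ x e) :=
  (φ.contDiff.continuous_fderiv (by simp)).clm_apply continuous_const

lemma hasCompactSupport_partial (Ω : Opens (EuclideanSpace ℝ (Fin d))) (φ : 𝓓(Ω, ℝ))
    (e : EuclideanSpace ℝ (Fin d)) : HasCompactSupport (fun x => fderiv ℝ φ x e) :=
  φ.hasCompactSupport.fderiv_apply (𝕜 := ℝ) e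

lemma memLp_coord (Ω : Opens (EuclideanSpace ℝ (Fin d)))
    (g : Lp (EuclideanSpace ℝ (Fin d)) 2
      (volume.restrict (Ω : Set (EuclideanSpace ℝ (Fin d))))) (i : Fin d) :
    MemLp (fun x => g x i) 2 (volume.restrict (Ω : Set (EuclideanSpace ℝ (Fin d)))) :=
  (EuclideanSpace.proj (𝕜 := ℝ) i).comp_memLp' (Lp.memLp g)

/-- The Sobolev space `H¹(Ω)`, as the subspace of all pairs `(u, ∇u)`, with its usual
Hilbert norm `(‖u‖²_{L²} + ‖∇u‖²_{L²})^(1/2)`. -/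
def H1 (Ω : Opens (EuclideanSpace ℝ (Fin d))) : Submodule ℝ (L2Pair Ω) where
  carrier := {p | IsWeakGradient Ω p.fst p.snd}
  zero_mem' := by
    intro φ i
    have h1 := Lp.coeFn_zero ℝ 2 (volume.restrict (Ω : Set (EuclideanSpace ℝ (Fin d))))
    have h2 := Lp.coeFn_zero (EuclideanSpace ℝ (Fin d)) 2
      (volume.restrict (Ω : Set (EuclideanSpace ℝ (Fin d))))
    rw [integral_eq_zero_of_ae, integral_eq_zero_of_ae, neg_zero]
    · filter_upwards [h2] with x hx
      have : (0 : L2Pair Ω).snd x = 0 := hx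
      rw [this]; simp
    · filter_upwards [h1] with x hx
      have : (0 : L2Pair Ω).fst x = 0 := hx
      rw [this]; simp
  add_mem' := by
    intro p q hp hq φ i
    have h1 := Lp.coeFn_add p.fst q.fst
    have h2 := Lp.coeFn_add p.snd q.snd
    have e1 := integral_congr_ae (μ := volume.restrict (Ω : Set (EuclideanSpace ℝ (Fin d))))
      (f := fun x => (p + q).fst x * fderiv ℝ φ x (EuclideanSpace.single i 1))
      (g := fun x => p.fst x * fderiv ℝ φ x (EuclideanSpace.single i 1) +
        q.fst x * fderiv ℝ φ x (EuclideanSpace.single i 1))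
      (by
        filter_upwards [h1] with x hx
        have : (p + q).fst x = p.fst x + q.fst x := hx
        rw [this, add_mul])
    have e2 := integral_congr_ae (μ := volume.restrict (Ω : Set (EuclideanSpace ℝ (Fin d))))
      (f := fun x => (p + q).snd x i * φ x)
      (g := fun x => p.snd x i * φ x + q.snd x i * φ x)
      (by
        filter_upwards [h2] with x hx
        have : (p + q).snd x = p.snd x + q.snd x := hx
        rw [this, PiLp.add_apply, add_mul])
    have c := continuous_partial Ω φ (EuclideanSpace.single i 1)
    have s := hasCompactSupport_partial Ω φ (EuclideanSpace.single i 1)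
    rw [e1, e2, integral_add (integrable_mul_of_compactSupport Ω (Lp.memLp p.fst) c s)
        (integrable_mul_of_compactSupport Ω (Lp.memLp q.fst) c s),
      integral_add
        (integrable_mul_of_compactSupport Ω (memLp_coord Ω p.snd i)
          φ.contDiff.continuous φ.hasCompactSupport)
        (integrable_mul_of_compactSupport Ω (memLp_coord Ω q.snd i)
          φ.contDiff.continuous φ.hasCompactSupport),
      hp φ i, hq φ i]
    ring
  smul_mem' := by
    intro c p hp φ i
    have h1 := Lp.coeFn_smul c p.fst
    have h2 := Lp.coeFn_smul c p.snd
    have e1 := integral_congr_ae (μ := volume.restrict (Ω : Set (EuclideanSpace ℝ (Fin d))))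
      (f := fun x => (c • p).fst x * fderiv ℝ φ x (EuclideanSpace.single i 1))
      (g := fun x => c * (p.fst x * fderiv ℝ φ x (EuclideanSpace.single i 1)))
      (by filter_upwards [h1] with x hx; simp [hx, mul_assoc])
    have e2 := integral_congr_ae (μ := volume.restrict (Ω : Set (EuclideanSpace ℝ (Fin d))))
      (f := fun x => (c • p).snd x i * φ x)
      (g := fun x => c * (p.snd x i * φ x))
      (by filter_upwards [h2] with x hx; simp [hx, mul_assoc])
    rw [e1, e2, integral_const_mul, integral_const_mul, hp φ i]
    ring

/-- A representative of the function underlying an element of `H¹(Ω)`. -/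
def H1.val {Ω : Opens (EuclideanSpace ℝ (Fin d))} (u : H1 Ω) : EuclideanSpace ℝ (Fin d) → ℝ :=
  (u : L2Pair Ω).fst

/-- A representative of the weak gradient of an element of `H¹(Ω)`. -/
def H1.grad {Ω : Opens (EuclideanSpace ℝ (Fin d))} (u : H1 Ω) :
    EuclideanSpace ℝ (Fin d) → EuclideanSpace ℝ (Fin d) :=
  (u : L2Pair Ω).snd

/-- The elements of `H¹(Ω)` that are (a.e. equal to) a smooth function with compact support
in `Ω`. -/
def testSubspace (Ω : Opens (EuclideanSpace ℝ (Fin d))) : Submodule ℝ (H1 Ω) where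
  carrier := {u | ∃ φ : 𝓓(Ω, ℝ),
    H1.val u =ᵐ[volume.restrict (Ω : Set (EuclideanSpace ℝ (Fin d)))] φ}
  zero_mem' := ⟨0, by
    filter_upwards [Lp.coeFn_zero ℝ 2
      (volume.restrict (Ω : Set (EuclideanSpace ℝ (Fin d))))] with x hx
    simpa [H1.val] using hx⟩
  add_mem' := by
    rintro u v ⟨φ, hφ⟩ ⟨ψ, hψ⟩
    refine ⟨φ + ψ, ?_⟩
    filter_upwards [hφ, hψ, Lp.coeFn_add (u : L2Pair Ω).fst (v : L2Pair Ω).fst] with x h1 h2 h3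
    have h4 : H1.val (u + v) x = H1.val u x + H1.val v x := h3
    rw [h4, h1, h2]
    simp
  smul_mem' := by
    rintro c u ⟨φ, hφ⟩
    refine ⟨c • φ, ?_⟩
    filter_upwards [hφ, Lp.coeFn_smul c (u : L2Pair Ω).fst] with x h1 h3
    simp only [H1.val] at h1 ⊢
    simp [h3, h1]

/-- `H¹₀(Ω)`: the closure of the test functions in `H¹(Ω)`, with the norm of `H¹(Ω)`. -/
def H10 (Ω : Opens (EuclideanSpace ℝ (Fin d))) : Submodule ℝ (H1 Ω) :=
  (testSubspace Ω).topologicalClosure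

/-- `w = σ v` almost everywhere in `Ω`. -/
def IsProduct {Ω : Opens (EuclideanSpace ℝ (Fin d))} (σ v w : H1 Ω) : Prop :=
  H1.val w =ᵐ[volume.restrict (Ω : Set (EuclideanSpace ℝ (Fin d)))]
    fun x => H1.val σ x * H1.val v x

/-- The modified advection field `B = ∇σ + σ b`. -/
def advField {Ω : Opens (EuclideanSpace ℝ (Fin d))}
    (b : EuclideanSpace ℝ (Fin d) → EuclideanSpace ℝ (Fin d)) (σ : H1 Ω) :
    EuclideanSpace ℝ (Fin d) → EuclideanSpace ℝ (Fin d) :=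
  fun x => H1.grad σ x + H1.val σ x • b x

/-- The integrand `σ ∇u · ∇v + B · ((∇u) v - (∇v) u) / 2`. -/
def aSSIntegrand {Ω : Opens (EuclideanSpace ℝ (Fin d))}
    (b : EuclideanSpace ℝ (Fin d) → EuclideanSpace ℝ (Fin d)) (σ u v : H1 Ω) :
    EuclideanSpace ℝ (Fin d) → ℝ :=
  fun x => H1.val σ x * inner ℝ (H1.grad u x) (H1.grad v x) +
    inner ℝ (advField b σ x)
      ((1 / 2 : ℝ) • (H1.val v x • H1.grad u x - H1.val u x • H1.grad v x))

/-- The skew-symmetric form `a_ss(σ; u, v)`. -/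
def aSS {Ω : Opens (EuclideanSpace ℝ (Fin d))}
    (b : EuclideanSpace ℝ (Fin d) → EuclideanSpace ℝ (Fin d)) (σ u v : H1 Ω) : ℝ :=
  ∫ x in (Ω : Set (EuclideanSpace ℝ (Fin d))), aSSIntegrand b σ u v x

/-- `u ∈ U` solves the discrete problem: `a_ss(σ; u, v) = F(σ v)` for all `v ∈ U`. -/
def IsDiscreteSolution {Ω : Opens (EuclideanSpace ℝ (Fin d))}
    (b : EuclideanSpace ℝ (Fin d) → EuclideanSpace ℝ (Fin d)) (σ : H1 Ω)
    (U : Submodule ℝ (H10 Ω)) (F : StrongDual ℝ (H10 Ω)) (u : H10 Ω) : Prop :=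
  u ∈ U ∧ ∀ v ∈ U, ∃ w : H10 Ω, IsProduct σ (v : H1 Ω) (w : H1 Ω) ∧
    aSS b σ (u : H1 Ω) (v : H1 Ω) = F w

end SkewGalerkin

end

open MeasureTheory TopologicalSpace Distributions

noncomputable section

namespace SkewGalerkin

open Filter Topology
open scoped ContDiff

/-! The only obstacle is that neither `σ` nor `∇σ` is assumed bounded, so it is not evident that
`σ∇u` and `u B` lie in `L²`. The multiplier hypothesis supplies this. By the closed graph theorem `v
↦ σv` is a bounded operator `T` on `H¹₀` (`exists_mulOp`). Iterating gives `‖σⁿv‖ ≤ ‖T‖ⁿ‖v‖`, which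
forces `|σ| ≤ ‖T‖ + 1` a.e. (`ae_bound_of_mulOp`), so `σ∇v` is in `L²`. The product rule
(`isWeakGradient_mul`) then gives `v∇σ = ∇(Tv) - σ∇v`, also in `L²`. Hence `v ↦ σ∇v` and `v ↦ vB`
are bounded operators (`exists_coefficient_ops`), and the form is a combination of `L²` inner
products (`exists_form`).

On the diagonal the skew part vanishes, leaving `∫ σ|∇u|²`; `poincare` turns this into coercivity.
The right-hand side is the functional `F ∘ T`, so Lax–Milgram on each closed subspace applies, with
a constant that sees only `‖T‖` and the coercivity constant (`galerkin`). -/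

/-- Pairing with a fixed `L²` function is continuous on `L²`. -/
lemma continuous_integral_inner {α E : Type*} [MeasurableSpace α] {μ : Measure α}
    [NormedAddCommGroup E] [InnerProductSpace ℝ E] {f : α → E} (hf : MemLp f 2 μ) :
    Continuous fun p : Lp E 2 μ => ∫ x, inner ℝ (f x) (p x) ∂μ := by
  have h : (fun p : Lp E 2 μ => ∫ x, inner ℝ (f x) (p x) ∂μ) =
      fun p => inner ℝ (hf.toLp f) p := by
    funext p
    rw [L2.inner_def]
    refine integral_congr_ae ?_
    filter_upwards [hf.coeFn_toLp] with x hx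
    rw [hx]
  rw [h]
  fun_prop

/-- A convergent sequence in `L^p` has an a.e. convergent subsequence. -/
lemma exists_subseq_tendsto_ae {α E : Type*} [MeasurableSpace α] {μ : Measure α}
    [NormedAddCommGroup E] {p : ENNReal} [Fact (1 ≤ p)] {f : ℕ → Lp E p μ} {g : Lp E p μ}
    (h : Tendsto f atTop (𝓝 g)) :
    ∃ ns : ℕ → ℕ, StrictMono ns ∧ ∀ᵐ x ∂μ, Tendsto (fun i => f (ns i) x) atTop (𝓝 (g x)) :=
  (tendstoInMeasure_of_tendsto_Lp h).exists_seq_tendsto_ae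

variable {d : ℕ} {Ω : Opens (EuclideanSpace ℝ (Fin d))}

/-! ### Test functions and weak gradients -/

/-- The product of a smooth function and a test function. -/
def smoothMul (f : EuclideanSpace ℝ (Fin d) → ℝ) (hf : ContDiff ℝ ∞ f) (φ : 𝓓(Ω, ℝ)) :
    𝓓(Ω, ℝ) where
  toFun x := f x * φ x
  contDiff' := hf.mul φ.contDiff
  hasCompactSupport' := φ.hasCompactSupport.mul_left
  tsupport_subset' := (tsupport_mul_subset_right (f := f)).trans φ.tsupport_subset

@[simp]
lemma smoothMul_apply (f : EuclideanSpace ℝ (Fin d) → ℝ) (hf : ContDiff ℝ ∞ f) (φ : 𝓓(Ω, ℝ))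
    (x : EuclideanSpace ℝ (Fin d)) : smoothMul f hf φ x = f x * φ x := rfl

lemma fderiv_smoothMul (f : EuclideanSpace ℝ (Fin d) → ℝ) (hf : ContDiff ℝ ∞ f) (φ : 𝓓(Ω, ℝ))
    (x e : EuclideanSpace ℝ (Fin d)) :
    fderiv ℝ (smoothMul f hf φ) x e = f x * fderiv ℝ φ x e + φ x * fderiv ℝ f x e := by
  have h : (smoothMul f hf φ : EuclideanSpace ℝ (Fin d) → ℝ) = fun x => f x * φ x := rfl
  rw [h, fderiv_fun_mul ((hf.differentiable (by simp)) x) ((φ.contDiff.differentiable (by simp)) x)]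
  simp

/-- The gradient of a test function. -/
def testGrad (φ : 𝓓(Ω, ℝ)) (x : EuclideanSpace ℝ (Fin d)) : EuclideanSpace ℝ (Fin d) :=
  WithLp.toLp 2 fun i => fderiv ℝ φ x (EuclideanSpace.single i 1)

@[simp]
lemma testGrad_apply (φ : 𝓓(Ω, ℝ)) (x : EuclideanSpace ℝ (Fin d)) (i : Fin d) :
    testGrad φ x i = fderiv ℝ φ x (EuclideanSpace.single i 1) := rfl

lemma continuous_testGrad (φ : 𝓓(Ω, ℝ)) : Continuous (testGrad φ) :=
  (PiLp.continuous_toLp 2 _).comp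
    (continuous_pi fun i => continuous_partial Ω φ (EuclideanSpace.single i 1))

lemma hasCompactSupport_testGrad (φ : 𝓓(Ω, ℝ)) : HasCompactSupport (testGrad φ) :=
  (φ.hasCompactSupport.fderiv (𝕜 := ℝ)).comp_left
    (g := fun L : EuclideanSpace ℝ (Fin d) →L[ℝ] ℝ =>
      (WithLp.toLp 2 fun i => L (EuclideanSpace.single i 1) : EuclideanSpace ℝ (Fin d)))
    (by ext; simp)

lemma memLp_test (φ : 𝓓(Ω, ℝ)) :
    MemLp φ 2 (volume.restrict (Ω : Set (EuclideanSpace ℝ (Fin d)))) :=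
  (φ.continuous.memLp_of_hasCompactSupport φ.hasCompactSupport).restrict _

lemma memLp_testGrad (φ : 𝓓(Ω, ℝ)) :
    MemLp (testGrad φ) 2 (volume.restrict (Ω : Set (EuclideanSpace ℝ (Fin d)))) :=
  ((continuous_testGrad φ).memLp_of_hasCompactSupport (hasCompactSupport_testGrad φ)).restrict _

/-- Both functions vanish off `Ω`, so the integrals extend to the whole space and integration by
parts there needs no regularity of the boundary. -/
lemma isWeakGradient_test (φ : 𝓓(Ω, ℝ)) : IsWeakGradient Ω φ (testGrad φ) := by
  intro ψ i
  have hψ0 : ∀ x, x ∉ (Ω : Set (EuclideanSpace ℝ (Fin d))) → φ x = 0 := fun x hx =>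
    image_eq_zero_of_notMem_tsupport fun h => hx (φ.tsupport_subset h)
  have hψ1 : ∀ x, x ∉ (Ω : Set (EuclideanSpace ℝ (Fin d))) → ψ x = 0 := fun x hx =>
    image_eq_zero_of_notMem_tsupport fun h => hx (ψ.tsupport_subset h)
  rw [setIntegral_eq_integral_of_forall_compl_eq_zero (fun x hx => by simp [hψ0 x hx]),
    setIntegral_eq_integral_of_forall_compl_eq_zero (fun x hx => by simp [hψ1 x hx])]
  have c := continuous_partial Ω φ (EuclideanSpace.single i 1)
  have c' := continuous_partial Ω ψ (EuclideanSpace.single i 1)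
  refine integral_mul_fderiv_eq_neg_fderiv_mul_of_integrable ?_ ?_ ?_
    (fun x _ => φ.contDiff.differentiable (by simp) x)
    (fun x _ => ψ.contDiff.differentiable (by simp) x)
  · exact (c.mul ψ.continuous).integrable_of_hasCompactSupport ψ.hasCompactSupport.mul_left
  · exact (φ.continuous.mul c').integrable_of_hasCompactSupport φ.hasCompactSupport.mul_right
  · exact (φ.continuous.mul ψ.continuous).integrable_of_hasCompactSupport
      φ.hasCompactSupport.mul_right

lemma IsWeakGradient.congr {u u' : EuclideanSpace ℝ (Fin d) → ℝ}
    {g g' : EuclideanSpace ℝ (Fin d) → EuclideanSpace ℝ (Fin d)} (h : IsWeakGradient Ω u g)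
    (hu : u =ᵐ[volume.restrict (Ω : Set (EuclideanSpace ℝ (Fin d)))] u')
    (hg : g =ᵐ[volume.restrict (Ω : Set (EuclideanSpace ℝ (Fin d)))] g') :
    IsWeakGradient Ω u' g' := by
  intro φ i
  have h1 := h φ i
  rwa [integral_congr_ae (f := fun x => u x * fderiv ℝ φ x (EuclideanSpace.single i 1))
      (g := fun x => u' x * fderiv ℝ φ x (EuclideanSpace.single i 1))
      (by filter_upwards [hu] with x hx; rw [hx]),
    integral_congr_ae (f := fun x => g x i * φ x) (g := fun x => g' x i * φ x)
      (by filter_upwards [hg] with x hx; rw [hx])] at h1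

/-- Weak gradients are unique. -/
lemma IsWeakGradient.ae_eq {u : EuclideanSpace ℝ (Fin d) → ℝ}
    {g g' : EuclideanSpace ℝ (Fin d) → EuclideanSpace ℝ (Fin d)}
    (h : IsWeakGradient Ω u g) (h' : IsWeakGradient Ω u g')
    (hg : LocallyIntegrable g (volume.restrict (Ω : Set (EuclideanSpace ℝ (Fin d)))))
    (hg' : LocallyIntegrable g' (volume.restrict (Ω : Set (EuclideanSpace ℝ (Fin d))))) :
    g =ᵐ[volume.restrict (Ω : Set (EuclideanSpace ℝ (Fin d)))] g' := by
  have hcoord : ∀ {k : EuclideanSpace ℝ (Fin d) → EuclideanSpace ℝ (Fin d)},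
      LocallyIntegrable k (volume.restrict (Ω : Set (EuclideanSpace ℝ (Fin d)))) →
        ∀ i : Fin d, LocallyIntegrable (fun x => k x i)
          (volume.restrict (Ω : Set (EuclideanSpace ℝ (Fin d)))) := by
    intro k hk i x
    obtain ⟨s, hs, hks⟩ := hk x
    exact ⟨s, hs, (EuclideanSpace.proj (𝕜 := ℝ) i).integrable_comp hks⟩
  have key : ∀ i : Fin d, ∀ᵐ x ∂(volume.restrict (Ω : Set (EuclideanSpace ℝ (Fin d)))),
      g x i - g' x i = 0 := by
    intro i
    refine (ae_restrict_iff' Ω.isOpen.measurableSet).2 ?_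
    -- The fundamental lemma of the calculus of variations, one coordinate at a time.
    refine Ω.isOpen.ae_eq_zero_of_integral_contDiff_smul_eq_zero
      (locallyIntegrableOn_of_locallyIntegrable_restrict ((hcoord hg i).sub (hcoord hg' i))) ?_
    intro φ hφ hc hs
    let ψ : 𝓓(Ω, ℝ) := ⟨φ, hφ, hc, hs⟩
    have e := (h ψ i).symm.trans (h' ψ i)
    have hint : ∀ {k : EuclideanSpace ℝ (Fin d) → EuclideanSpace ℝ (Fin d)},
        LocallyIntegrable k (volume.restrict (Ω : Set (EuclideanSpace ℝ (Fin d)))) →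
          Integrable (fun x => k x i * φ x)
            (volume.restrict (Ω : Set (EuclideanSpace ℝ (Fin d)))) := by
      intro k hk
      simpa only [smul_eq_mul, mul_comm] using
        (hcoord hk i).integrable_smul_left_of_hasCompactSupport hφ.continuous hc
    have e2 : ∫ x in (Ω : Set (EuclideanSpace ℝ (Fin d))), φ x • (g x i - g' x i) = 0 := by
      have : (fun x => φ x • (g x i - g' x i)) = fun x => g x i * φ x - g' x i * φ x := by
        funext x; simp only [smul_eq_mul]; ring
      rw [this, integral_sub (hint hg) (hint hg')]
      have e' := neg_injective e
      change (∫ x in (Ω : Set (EuclideanSpace ℝ (Fin d))), g x i * φ x) =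
        ∫ x in (Ω : Set (EuclideanSpace ℝ (Fin d))), g' x i * φ x at e'
      rw [e', sub_self]
    rw [← e2]
    exact (setIntegral_eq_integral_of_forall_compl_eq_zero fun x hx => by
      rw [image_eq_zero_of_notMem_tsupport fun h => hx (hs h), zero_smul]).symm
  filter_upwards [ae_all_iff.2 key] with x hx
  ext i
  exact sub_eq_zero.1 (hx i)

/-! ### `H¹` and `H¹₀` as Hilbert spaces -/

lemma norm_sq_eq_integral {α E : Type*} [MeasurableSpace α] {μ : Measure α}
    [NormedAddCommGroup E] [InnerProductSpace ℝ E] (p : Lp E 2 μ) :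
    ‖p‖ ^ 2 = ∫ x, ‖p x‖ ^ 2 ∂μ := by
  rw [← real_inner_self_eq_norm_sq, L2.inner_def]
  simp_rw [real_inner_self_eq_norm_sq]

/-- The `L²` class of an element of `H¹(Ω)`. -/
def H1.valL (Ω : Opens (EuclideanSpace ℝ (Fin d))) :
    H1 Ω →L[ℝ] Lp ℝ 2 (volume.restrict (Ω : Set (EuclideanSpace ℝ (Fin d)))) :=
  (WithLp.fstL 2 ℝ _ _).comp (H1 Ω).subtypeL

/-- The `L²` class of the weak gradient of an element of `H¹(Ω)`. -/
def H1.gradL (Ω : Opens (EuclideanSpace ℝ (Fin d))) :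
    H1 Ω →L[ℝ] Lp (EuclideanSpace ℝ (Fin d)) 2
      (volume.restrict (Ω : Set (EuclideanSpace ℝ (Fin d)))) :=
  (WithLp.sndL 2 ℝ _ _).comp (H1 Ω).subtypeL

lemma H1.coe_valL (u : H1 Ω) : (H1.valL Ω u : EuclideanSpace ℝ (Fin d) → ℝ) = H1.val u := rfl

lemma H1.coe_gradL (u : H1 Ω) :
    (H1.gradL Ω u : EuclideanSpace ℝ (Fin d) → EuclideanSpace ℝ (Fin d)) = H1.grad u := rfl

lemma H1.norm_sq_eq (u : H1 Ω) : ‖u‖ ^ 2 = ‖H1.valL Ω u‖ ^ 2 + ‖H1.gradL Ω u‖ ^ 2 :=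
  WithLp.prod_norm_sq_eq_of_L2 (u : L2Pair Ω)

lemma H1.memLp_val (u : H1 Ω) :
    MemLp (H1.val u) 2 (volume.restrict (Ω : Set (EuclideanSpace ℝ (Fin d)))) :=
  Lp.memLp (H1.valL Ω u)

lemma H1.memLp_grad (u : H1 Ω) :
    MemLp (H1.grad u) 2 (volume.restrict (Ω : Set (EuclideanSpace ℝ (Fin d)))) :=
  Lp.memLp (H1.gradL Ω u)

lemma H1.isWeakGradient (u : H1 Ω) : IsWeakGradient Ω (H1.val u) (H1.grad u) := u.2

/-- An element of `H¹(Ω)` is determined by its underlying function. -/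
lemma H1.ext_val {u v : H1 Ω}
    (h : H1.val u =ᵐ[volume.restrict (Ω : Set (EuclideanSpace ℝ (Fin d)))] H1.val v) : u = v := by
  have hg := ((H1.isWeakGradient u).congr h (EventuallyEq.refl _ _)).ae_eq (H1.isWeakGradient v)
    ((H1.memLp_grad u).locallyIntegrable (by norm_num)) ((H1.memLp_grad v).locallyIntegrable (by norm_num))
  exact Subtype.ext (WithLp.ofLp_injective 2 (Prod.ext (Lp.ext h) (Lp.ext hg)))

/-- The element of `H¹(Ω)` given by an `L²` function with a weak gradient in `L²`. -/
def H1.mk {u : EuclideanSpace ℝ (Fin d) → ℝ}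
    {g : EuclideanSpace ℝ (Fin d) → EuclideanSpace ℝ (Fin d)}
    (hu : MemLp u 2 (volume.restrict (Ω : Set (EuclideanSpace ℝ (Fin d)))))
    (hg : MemLp g 2 (volume.restrict (Ω : Set (EuclideanSpace ℝ (Fin d)))))
    (h : IsWeakGradient Ω u g) : H1 Ω :=
  ⟨WithLp.toLp 2 (hu.toLp u, hg.toLp g), h.congr hu.coeFn_toLp.symm hg.coeFn_toLp.symm⟩

/-- A test function as an element of `H¹(Ω)`. -/
def testH1 (φ : 𝓓(Ω, ℝ)) : H1 Ω := H1.mk (memLp_test φ) (memLp_testGrad φ) (isWeakGradient_test φ)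

lemma val_testH1 (φ : 𝓓(Ω, ℝ)) :
    H1.val (testH1 φ) =ᵐ[volume.restrict (Ω : Set (EuclideanSpace ℝ (Fin d)))] φ :=
  (memLp_test φ).coeFn_toLp

lemma grad_testH1 (φ : 𝓓(Ω, ℝ)) :
    H1.grad (testH1 φ) =ᵐ[volume.restrict (Ω : Set (EuclideanSpace ℝ (Fin d)))] testGrad φ :=
  (memLp_testGrad φ).coeFn_toLp

lemma testH1_mem_H10 (φ : 𝓓(Ω, ℝ)) : testH1 φ ∈ H10 Ω :=
  subset_closure (s := (testSubspace Ω : Set (H1 Ω))) ⟨φ, val_testH1 φ⟩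

/-- A closed property of elements of `H¹(Ω)` that holds for test functions holds on `H¹₀(Ω)`. -/
lemma H10_induction {P : H1 Ω → Prop} (hP : IsClosed {u | P u})
    (h : ∀ φ : 𝓓(Ω, ℝ), P (testH1 φ)) {u : H1 Ω} (hu : u ∈ H10 Ω) : P u := by
  refine closure_minimal (s := (testSubspace Ω : Set (H1 Ω))) ?_ hP hu
  rintro v ⟨φ, hφ⟩
  have : v = testH1 φ := H1.ext_val (hφ.trans (val_testH1 φ).symm)
  rw [this]
  exact h φ

lemma memLp_mul_of_compactSupport {f ψ : EuclideanSpace ℝ (Fin d) → ℝ}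
    (hf : MemLp f 2 (volume.restrict (Ω : Set (EuclideanSpace ℝ (Fin d)))))
    (hc : Continuous ψ) (hs : HasCompactSupport ψ) :
    MemLp (fun x => f x * ψ x) 2 (volume.restrict (Ω : Set (EuclideanSpace ℝ (Fin d)))) :=
  (hc.memLp_top_of_hasCompactSupport hs _).mul' hf

lemma memLp_smul_single {f : EuclideanSpace ℝ (Fin d) → ℝ}
    (hf : MemLp f 2 (volume.restrict (Ω : Set (EuclideanSpace ℝ (Fin d))))) (i : Fin d) :
    MemLp (fun x => f x • (EuclideanSpace.single i 1 : EuclideanSpace ℝ (Fin d))) 2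
      (volume.restrict (Ω : Set (EuclideanSpace ℝ (Fin d)))) :=
  (ContinuousLinearMap.toSpanSingleton ℝ
    (EuclideanSpace.single i 1 : EuclideanSpace ℝ (Fin d))).comp_memLp' hf

lemma continuous_integral_val {f : EuclideanSpace ℝ (Fin d) → ℝ}
    (hf : MemLp f 2 (volume.restrict (Ω : Set (EuclideanSpace ℝ (Fin d))))) :
    Continuous fun p : Lp ℝ 2 (volume.restrict (Ω : Set (EuclideanSpace ℝ (Fin d)))) =>
      ∫ x in (Ω : Set (EuclideanSpace ℝ (Fin d))), p x * f x := by
  simpa using continuous_integral_inner hf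

lemma continuous_integral_coord {f : EuclideanSpace ℝ (Fin d) → ℝ}
    (hf : MemLp f 2 (volume.restrict (Ω : Set (EuclideanSpace ℝ (Fin d))))) (i : Fin d) :
    Continuous fun p : Lp (EuclideanSpace ℝ (Fin d)) 2
        (volume.restrict (Ω : Set (EuclideanSpace ℝ (Fin d)))) =>
      ∫ x in (Ω : Set (EuclideanSpace ℝ (Fin d))), p x i * f x := by
  have := continuous_integral_inner (memLp_smul_single hf i)
  simpa [real_inner_smul_left, EuclideanSpace.inner_single_left, mul_comm] using this

/-- Each defining identity equates two `L²` pairings with fixed compactly supported functions, hence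
is a closed condition. Completeness of `H¹` and `H¹₀` follows. -/
lemma isClosed_H1 : IsClosed (H1 Ω : Set (L2Pair Ω)) := by
  have : (H1 Ω : Set (L2Pair Ω)) = ⋂ (φ : 𝓓(Ω, ℝ)) (i : Fin d),
      {p : L2Pair Ω | ∫ x in (Ω : Set (EuclideanSpace ℝ (Fin d))),
          p.fst x * fderiv ℝ φ x (EuclideanSpace.single i 1) =
        -∫ x in (Ω : Set (EuclideanSpace ℝ (Fin d))), p.snd x i * φ x} := by
    ext p
    simp only [Set.mem_iInter]
    rfl
  rw [this]
  refine isClosed_iInter fun φ => isClosed_iInter fun i => isClosed_eq ?_ (Continuous.neg ?_)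
  · exact (continuous_integral_val (((continuous_partial Ω φ _).memLp_of_hasCompactSupport
      (hasCompactSupport_partial Ω φ _)).restrict _)).comp (WithLp.fstL 2 ℝ _ _).continuous
  · exact (continuous_integral_coord (memLp_test φ) i).comp (WithLp.sndL 2 ℝ _ _).continuous

instance : CompleteSpace (H1 Ω) := isClosed_H1.completeSpace_coe

instance : CompleteSpace (H10 Ω) :=
  (Submodule.isClosed_topologicalClosure (testSubspace Ω)).completeSpace_coe

/-! ### Product rule and Poincaré inequality -/

/-- The product rule for a product of an `H¹` function and an `H¹₀` function. -/
lemma isWeakGradient_mul (σ : H1 Ω) {v : H1 Ω} (hv : v ∈ H10 Ω) :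
    IsWeakGradient Ω (fun x => H1.val σ x * H1.val v x)
      (fun x => H1.val σ x • H1.grad v x + H1.val v x • H1.grad σ x) := by
  intro ψ i
  have c := continuous_partial Ω ψ (EuclideanSpace.single i 1)
  have s := hasCompactSupport_partial Ω ψ (EuclideanSpace.single i 1)
  have m1 := memLp_mul_of_compactSupport (H1.memLp_val σ) c s
  have m2 := memLp_mul_of_compactSupport (H1.memLp_val σ) ψ.continuous ψ.hasCompactSupport
  have m3 := memLp_mul_of_compactSupport (memLp_coord Ω (H1.gradL Ω σ) i) ψ.continuous
    ψ.hasCompactSupport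
  -- Grouped so that `v` and `∇v` are paired only with fixed `L²` functions, the boundedness of `ψ`
  -- and its derivative being absorbed there. Both sides are then continuous in `v`, and density
  -- reduces to test functions.
  have key : (∫ x in (Ω : Set (EuclideanSpace ℝ (Fin d))), H1.val v x *
        (H1.val σ x * fderiv ℝ ψ x (EuclideanSpace.single i 1))) =
      -((∫ x in (Ω : Set (EuclideanSpace ℝ (Fin d))), H1.grad v x i * (H1.val σ x * ψ x)) +
        ∫ x in (Ω : Set (EuclideanSpace ℝ (Fin d))), H1.val v x * (H1.grad σ x i * ψ x)) := by
    refine H10_induction (P := fun v => (∫ x in (Ω : Set (EuclideanSpace ℝ (Fin d))), H1.val v x *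
        (H1.val σ x * fderiv ℝ ψ x (EuclideanSpace.single i 1))) =
      -((∫ x in (Ω : Set (EuclideanSpace ℝ (Fin d))), H1.grad v x i * (H1.val σ x * ψ x)) +
        ∫ x in (Ω : Set (EuclideanSpace ℝ (Fin d))), H1.val v x * (H1.grad σ x i * ψ x)))
      ?_ ?_ hv
    · exact isClosed_eq ((continuous_integral_val m1).comp (H1.valL Ω).continuous)
        (((continuous_integral_coord m2 i).comp (H1.gradL Ω).continuous).add
          ((continuous_integral_val m3).comp (H1.valL Ω).continuous)).neg
    · intro φ
      -- For `v = φ` the identity is the definition of `∇σ` tested against `φψ`.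
      have e := (H1.isWeakGradient σ) (smoothMul φ φ.contDiff ψ) i
      simp only [fderiv_smoothMul, smoothMul_apply] at e
      have hval := val_testH1 φ
      have hgrad := grad_testH1 φ
      have i1 : Integrable (fun x => H1.val σ x *
          (φ x * fderiv ℝ ψ x (EuclideanSpace.single i 1)))
          (volume.restrict (Ω : Set (EuclideanSpace ℝ (Fin d)))) :=
        integrable_mul_of_compactSupport Ω (H1.memLp_val σ) (φ.continuous.mul c)
          φ.hasCompactSupport.mul_right
      have i2 : Integrable (fun x => H1.val σ x *
          (ψ x * fderiv ℝ φ x (EuclideanSpace.single i 1)))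
          (volume.restrict (Ω : Set (EuclideanSpace ℝ (Fin d)))) :=
        integrable_mul_of_compactSupport Ω (H1.memLp_val σ)
          (ψ.continuous.mul (continuous_partial Ω φ _)) ψ.hasCompactSupport.mul_right
      simp only [mul_add] at e
      rw [integral_add i1 i2] at e
      rw [integral_congr_ae (g := fun x => H1.val σ x *
          (φ x * fderiv ℝ ψ x (EuclideanSpace.single i 1)))
          (by filter_upwards [hval] with x hx; rw [hx]; ring),
        integral_congr_ae (f := fun x => H1.grad (testH1 φ) x i * _) (g := fun x => H1.val σ x *
          (ψ x * fderiv ℝ φ x (EuclideanSpace.single i 1)))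
          (by filter_upwards [hgrad] with x hx; rw [hx, testGrad_apply]; ring),
        integral_congr_ae (f := fun x => H1.val (testH1 φ) x * _)
          (g := fun x => H1.grad σ x i * (φ x * ψ x))
          (by filter_upwards [hval] with x hx; rw [hx]; ring)]
      linarith
  have j1 : Integrable (fun x => H1.grad v x i * (H1.val σ x * ψ x))
      (volume.restrict (Ω : Set (EuclideanSpace ℝ (Fin d)))) :=
    (memLp_coord Ω (H1.gradL Ω v) i).integrable_mul m2
  have j2 : Integrable (fun x => H1.val v x * (H1.grad σ x i * ψ x))
      (volume.restrict (Ω : Set (EuclideanSpace ℝ (Fin d)))) :=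
    (H1.memLp_val v).integrable_mul m3
  rw [← integral_add j1 j2] at key
  convert key using 2
  · funext x; ring
  · refine integral_congr_ae (.of_forall fun x => ?_)
    simp only [PiLp.add_apply, PiLp.smul_apply, smul_eq_mul]
    ring

/-- The Poincaré inequality on a bounded open set. -/
lemma poincare (i : Fin d) {R : ℝ} (hR : ∀ x ∈ Ω, ‖x‖ ≤ R) {u : H1 Ω} (hu : u ∈ H10 Ω) :
    ‖H1.valL Ω u‖ ^ 2 ≤ 4 * R ^ 2 * ‖H1.gradL Ω u‖ ^ 2 := by
  refine H10_induction (P := fun u => ‖H1.valL Ω u‖ ^ 2 ≤ 4 * R ^ 2 * ‖H1.gradL Ω u‖ ^ 2)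
    (isClosed_le (by fun_prop) (by fun_prop)) (fun φ => ?_) hu
  rw [norm_sq_eq_integral, norm_sq_eq_integral, H1.coe_valL, H1.coe_gradL,
    integral_congr_ae (g := fun x => φ x ^ 2)
      (by filter_upwards [val_testH1 φ] with x hx; rw [hx, Real.norm_eq_abs, sq_abs]),
    integral_congr_ae (f := fun x => ‖H1.grad (testH1 φ) x‖ ^ 2) (g := fun x => ‖testGrad φ x‖ ^ 2)
      (by filter_upwards [grad_testH1 φ] with x hx; rw [hx])]
  have hcoord : ContDiff ℝ ∞ fun x : EuclideanSpace ℝ (Fin d) => x i :=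
    (EuclideanSpace.proj (𝕜 := ℝ) i).contDiff
  have hder : ∀ x : EuclideanSpace ℝ (Fin d),
      fderiv ℝ (fun x : EuclideanSpace ℝ (Fin d) => x i) x (EuclideanSpace.single i 1) = 1 := by
    intro x
    have : fderiv ℝ (fun x : EuclideanSpace ℝ (Fin d) => x i) x =
      EuclideanSpace.proj (𝕜 := ℝ) i := (EuclideanSpace.proj (𝕜 := ℝ) i).fderiv
    rw [this]; simp
  -- Testing against `xᵢφ` gives `∫ φ² = -2 ∫ φ xᵢ ∂ᵢφ`, since `∂ᵢxᵢ = 1`.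
  have e := isWeakGradient_test φ (smoothMul _ hcoord φ) i
  simp only [fderiv_smoothMul, smoothMul_apply, hder, mul_one, testGrad_apply] at e
  have i0 : Integrable (fun x => φ x ^ 2)
      (volume.restrict (Ω : Set (EuclideanSpace ℝ (Fin d)))) :=
    (memLp_test φ).integrable_sq
  have i1 : Integrable (fun x => ‖testGrad φ x‖ ^ 2)
      (volume.restrict (Ω : Set (EuclideanSpace ℝ (Fin d)))) :=
    (memLp_testGrad φ).norm.integrable_sq
  have i2 : Integrable (fun x => φ x * (x i * fderiv ℝ φ x (EuclideanSpace.single i 1)))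
      (volume.restrict (Ω : Set (EuclideanSpace ℝ (Fin d)))) :=
    integrable_mul_of_compactSupport Ω (memLp_test φ)
      (hcoord.continuous.mul (continuous_partial Ω φ _))
      (hasCompactSupport_partial Ω φ _).mul_left
  have e1 : ∫ x in (Ω : Set (EuclideanSpace ℝ (Fin d))), φ x ^ 2 =
      ∫ x in (Ω : Set (EuclideanSpace ℝ (Fin d))),
        (-2) * (φ x * (x i * fderiv ℝ φ x (EuclideanSpace.single i 1))) := by
    have a1 : (fun x => φ x * (x i * fderiv ℝ φ x (EuclideanSpace.single i 1) + φ x)) =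
        fun x => φ x * (x i * fderiv ℝ φ x (EuclideanSpace.single i 1)) + φ x ^ 2 := by
      funext x; ring
    have a2 : (fun x : EuclideanSpace ℝ (Fin d) =>
        fderiv ℝ φ x (EuclideanSpace.single i 1) * (x i * φ x)) =
        fun x => φ x * (x i * fderiv ℝ φ x (EuclideanSpace.single i 1)) := by
      funext x; ring
    rw [a1, a2, integral_add i2 i0] at e
    rw [integral_const_mul]
    linarith
  have e2 : ∫ x in (Ω : Set (EuclideanSpace ℝ (Fin d))),
        (-2) * (φ x * (x i * fderiv ℝ φ x (EuclideanSpace.single i 1))) ≤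
      ∫ x in (Ω : Set (EuclideanSpace ℝ (Fin d))),
        ((1 / 2) * φ x ^ 2 + 2 * R ^ 2 * ‖testGrad φ x‖ ^ 2) := by
    refine integral_mono_ae (i2.const_mul _) ((i0.const_mul _).add (i1.const_mul _)) ?_
    refine (ae_restrict_iff' Ω.isOpen.measurableSet).2 (.of_forall fun x hx => ?_)
    have h1 : |x i| ≤ R := (PiLp.norm_apply_le x i).trans (hR x hx)
    have h2 : |fderiv ℝ φ x (EuclideanSpace.single i 1)| ≤ ‖testGrad φ x‖ :=
      PiLp.norm_apply_le (testGrad φ x) i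
    have h3 : (x i * fderiv ℝ φ x (EuclideanSpace.single i 1)) ^ 2 ≤
        (R * ‖testGrad φ x‖) ^ 2 := by
      rw [sq_le_sq, abs_mul]
      exact (mul_le_mul h1 h2 (abs_nonneg _) ((abs_nonneg _).trans h1)).trans (le_abs_self _)
    -- Young's inequality, weighted to leave `φ²/2`, which is absorbed on the left; this produces
    -- the factor `4R²`.
    have h4 := sq_nonneg (φ x + 2 * (x i * fderiv ℝ φ x (EuclideanSpace.single i 1)))
    dsimp only
    nlinarith
  rw [← e1, integral_add (i0.const_mul _) (i1.const_mul _), integral_const_mul,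
    integral_const_mul] at e2
  linarith

/-! ### Multiplication by `σ` as a bounded operator -/

section Banach

variable {X : Type*} [NormedAddCommGroup X] [NormedSpace ℝ X]

/-- For real functions the bound needs an essential lower bound to exist. Without one the defining
supremum is over the empty set and equals the default value `0`, which positivity excludes. -/
lemma ae_essInf_le_of_pos {α : Type*} [MeasurableSpace α] {μ : Measure α} {f : α → ℝ}
    (h : 0 < essInf f μ) : ∀ᵐ x ∂μ, essInf f μ ≤ f x := by
  refine ae_essInf_le ?_
  by_contra hf
  rw [essInf_eq_sSup, Set.eq_empty_of_forall_notMem (s := {a | μ {x | f x < a} = 0}),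
    Real.sSup_empty] at h
  · exact h.false
  · intro a ha
    refine hf ⟨a, ?_⟩
    rw [eventually_map, ae_iff]
    simpa using ha

lemma IsProduct.unique {σ v w w' : H1 Ω} (h : IsProduct σ v w) (h' : IsProduct σ v w') : w = w' :=
  H1.ext_val (EventuallyEq.trans h (EventuallyEq.symm h'))

/-- Limits in `H¹(Ω)` of products with a fixed factor are products. -/
lemma IsProduct.of_tendsto {σ v w : H1 Ω} {v' w' : ℕ → H1 Ω} (h : ∀ n, IsProduct σ (v' n) (w' n))
    (hv : Tendsto v' atTop (𝓝 v)) (hw : Tendsto w' atTop (𝓝 w)) : IsProduct σ v w := by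
  obtain ⟨ns, hns, h1⟩ := exists_subseq_tendsto_ae (((H1.valL Ω).continuous.tendsto v).comp hv)
  -- Extracted inside the first subsequence, so that both factors converge a.e. along the same
  -- indices.
  obtain ⟨ms, hms, h2⟩ := exists_subseq_tendsto_ae
    ((((H1.valL Ω).continuous.tendsto w).comp hw).comp hns.tendsto_atTop)
  filter_upwards [h1, h2, ae_all_iff.2 h] with x hx1 hx2 hx
  refine tendsto_nhds_unique hx2 ?_
  have := (hx1.comp hms.tendsto_atTop).const_mul (H1.val σ x)
  refine this.congr fun n => ?_
  exact (hx (ns (ms n))).symm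

lemma H1.val_add (u v : H1 Ω) :
    H1.val (u + v) =ᵐ[volume.restrict (Ω : Set (EuclideanSpace ℝ (Fin d)))]
      fun x => H1.val u x + H1.val v x :=
  Lp.coeFn_add (H1.valL Ω u) (H1.valL Ω v)

lemma H1.val_smul (c : ℝ) (u : H1 Ω) :
    H1.val (c • u) =ᵐ[volume.restrict (Ω : Set (EuclideanSpace ℝ (Fin d)))]
      fun x => c * H1.val u x :=
  Lp.coeFn_smul c (H1.valL Ω u)

/-- A function that multiplies a Banach space `X` continuously included in `H¹(Ω)` into itself
does so continuously. -/
lemma exists_mulOp [CompleteSpace X] {J : X →L[ℝ] H1 Ω} (hJ : Function.Injective J) {σ : H1 Ω}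
    (hσ : ∀ v : X, ∃ w : X, IsProduct σ (J v) (J w)) :
    ∃ T : X →L[ℝ] X, ∀ v : X, IsProduct σ (J v) (J (T v)) := by
  choose T hT using hσ
  let L : X →ₗ[ℝ] X :=
    { toFun := T
      map_add' := fun u v => hJ <| (hT (u + v)).unique <| by
        filter_upwards [hT u, hT v, H1.val_add (J u) (J v), H1.val_add (J (T u)) (J (T v))]
          with x h1 h2 h3 h4
        rw [map_add, map_add, h3, h4, h1, h2, mul_add]
      map_smul' := fun c v => hJ <| (hT (c • v)).unique <| by
        filter_upwards [hT v, H1.val_smul c (J v), H1.val_smul c (J (T v))] with x h1 h2 h3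
        rw [RingHom.id_apply, map_smul, map_smul, h2, h3, h1]
        ring }
  -- Closed graph theorem: products survive limits in `H¹`, and injectivity of `J` brings the
  -- identity back to `X`.
  refine ⟨⟨L, L.continuous_of_seq_closed_graph fun v x y hv hy => hJ ?_⟩, hT⟩
  refine IsProduct.unique ?_ (hT x)
  exact IsProduct.of_tendsto (fun n => hT (v n)) ((J.continuous.tendsto x).comp hv)
    ((J.continuous.tendsto y).comp hy)

/-- Scaling by `‖T‖ + 1` instead of `‖T‖` makes the geometric ratio strictly less than one and
avoids dividing by zero when `T = 0`. -/
lemma tendsto_smul_iterate_zero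
    (T : X →L[ℝ] X) (v : X) :
    Tendsto (fun n : ℕ => ((‖T‖ + 1)⁻¹ ^ n) • T^[n] v) atTop (𝓝 0) := by
  have hK : 0 < ‖T‖ + 1 := by positivity
  have hr : ‖T‖ / (‖T‖ + 1) < 1 := by
    rw [div_lt_one hK]
    linarith
  refine squeeze_zero_norm (a := fun n => (‖T‖ / (‖T‖ + 1)) ^ n * ‖v‖) (fun n => ?_) ?_
  · have h : ‖T^[n] v‖ ≤ ‖T‖ ^ n * ‖v‖ := by
      induction n with
      | zero => simp
      | succ n ih =>
        rw [Function.iterate_succ_apply', pow_succ', mul_assoc]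
        exact (T.le_opNorm _).trans (by gcongr)
    rw [norm_smul, norm_pow, norm_inv, Real.norm_of_nonneg hK.le, div_eq_inv_mul, mul_pow,
      mul_assoc]
    gcongr
  · simpa using (tendsto_pow_atTop_nhds_zero_of_lt_one (by positivity) hr).mul_const ‖v‖

/-- A function that multiplies a Banach space of `H¹` functions containing the test functions into
itself is essentially bounded. -/
lemma ae_bound_of_mulOp {J : X →L[ℝ] H1 Ω} (hJt : ∀ φ : 𝓓(Ω, ℝ), testH1 φ ∈ Set.range J)
    {σ : H1 Ω} {T : X →L[ℝ] X} (hT : ∀ v : X, IsProduct σ (J v) (J (T v))) :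
    ∀ᵐ x ∂(volume.restrict (Ω : Set (EuclideanSpace ℝ (Fin d)))),
      ‖H1.val σ x‖ ≤ ‖T‖ + 1 := by
  have hK : 0 < ‖T‖ + 1 := by positivity
  have key : ∀ v : X, ∀ᵐ x ∂(volume.restrict (Ω : Set (EuclideanSpace ℝ (Fin d)))),
      H1.val (J v) x ≠ 0 → ‖H1.val σ x‖ ≤ ‖T‖ + 1 := by
    intro v
    have hpow : ∀ n : ℕ, ∀ᵐ x ∂(volume.restrict (Ω : Set (EuclideanSpace ℝ (Fin d)))),
        H1.val (J (T^[n] v)) x = H1.val σ x ^ n * H1.val (J v) x := by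
      intro n
      induction n with
      | zero => exact .of_forall fun x => by simp
      | succ n ih =>
        filter_upwards [ih, hT (T^[n] v)] with x h1 h2
        rw [Function.iterate_succ_apply', h2, h1]
        ring
    have hlim : Tendsto (fun n : ℕ => ((‖T‖ + 1)⁻¹ ^ n) • H1.valL Ω (J (T^[n] v)))
        atTop (𝓝 0) := by
      have := ((H1.valL Ω).comp J).continuous.tendsto 0 |>.comp
        (tendsto_smul_iterate_zero T v)
      rw [map_zero] at this
      refine this.congr fun n => ?_
      exact map_smul ((H1.valL Ω).comp J) _ _
    obtain ⟨ns, -, hns⟩ := exists_subseq_tendsto_ae hlim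
    filter_upwards [hns, ae_all_iff.2 hpow, ae_all_iff.2 fun n : ℕ => Lp.coeFn_smul
      ((‖T‖ + 1)⁻¹ ^ n) (H1.valL Ω (J (T^[n] v))), Lp.coeFn_zero ℝ 2
      (volume.restrict (Ω : Set (EuclideanSpace ℝ (Fin d))))] with x h1 h2 h4 h3 hv
    by_contra! hlt
    rw [h3] at h1
    -- At a point with `|σ| > ‖T‖ + 1` the scaled values of `σⁿv` never drop below `|v|`, yet they
    -- tend to `0` along a subsequence.
    have hge : ∀ i, ‖H1.val (J v) x‖ ≤
        ‖(((‖T‖ + 1)⁻¹ ^ ns i) • H1.valL Ω (J (T^[ns i] v)) :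
          Lp ℝ 2 (volume.restrict (Ω : Set (EuclideanSpace ℝ (Fin d))))) x‖ := by
      intro i
      rw [h4, Pi.smul_apply, H1.coe_valL, h2, smul_eq_mul, ← mul_assoc, ← mul_pow, norm_mul,
        norm_pow, norm_mul, norm_inv, Real.norm_of_nonneg hK.le]
      refine le_mul_of_one_le_left (norm_nonneg _) (one_le_pow₀ ?_)
      rw [← div_eq_inv_mul, one_le_div hK]
      exact hlt.le
    have := ge_of_tendsto h1.norm (.of_forall hge)
    simp only [Pi.zero_apply, norm_zero] at this
    exact hv (norm_le_zero_iff.1 this)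
  -- The bound holds where some `v` is nonzero; bump functions at each point of `Ω` make the
  -- exceptional set locally null, hence null.
  rw [ae_iff, Measure.restrict_apply' Ω.isOpen.measurableSet]
  refine measure_null_of_locally_null _ fun x hx => ?_
  obtain ⟨φ, hs, hc, hφ, -, hφx⟩ :=
    exists_contDiff_tsupport_subset (n := ⊤) (Ω.isOpen.mem_nhds hx.2)
  let ψ : 𝓓(Ω, ℝ) := ⟨φ, hφ, hc, hs⟩
  obtain ⟨v, hv⟩ := hJt ψ
  have hψ := key v
  rw [hv] at hψ
  have hbad : ∀ᵐ y ∂(volume.restrict (Ω : Set (EuclideanSpace ℝ (Fin d)))),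
      φ y ≠ 0 → ‖H1.val σ y‖ ≤ ‖T‖ + 1 := by
    filter_upwards [hψ, val_testH1 ψ] with y h1 h2 h3
    refine h1 ?_
    rw [h2]
    exact h3
  refine ⟨{y | φ y ≠ 0} ∩ ({y | ¬‖H1.val σ y‖ ≤ ‖T‖ + 1} ∩ Ω), ?_, ?_⟩
  · refine inter_mem (mem_nhdsWithin_of_mem_nhds ?_) self_mem_nhdsWithin
    exact hφ.continuous.continuousAt.eventually_ne (by rw [hφx]; exact one_ne_zero)
  · rw [ae_iff, Measure.restrict_apply' Ω.isOpen.measurableSet] at hbad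
    refine measure_mono_null ?_ hbad
    rintro y ⟨h1, h2, h3⟩
    exact ⟨fun h => h2 (h h1), h3⟩

/-- The multiplication operators `v ↦ σ ∇v` and `v ↦ v B` into `L²(Ω)^d`. -/
lemma exists_coefficient_ops {b : EuclideanSpace ℝ (Fin d) → EuclideanSpace ℝ (Fin d)}
    (hb : MemLp b ⊤ (volume.restrict (Ω : Set (EuclideanSpace ℝ (Fin d)))))
    {J : X →L[ℝ] H1 Ω} (hJ : ∀ v, J v ∈ H10 Ω) (hJt : ∀ φ : 𝓓(Ω, ℝ), testH1 φ ∈ Set.range J)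
    {σ : H1 Ω} {T : X →L[ℝ] X} (hT : ∀ v : X, IsProduct σ (J v) (J (T v))) :
    ∃ S Q : X →L[ℝ] Lp (EuclideanSpace ℝ (Fin d)) 2
        (volume.restrict (Ω : Set (EuclideanSpace ℝ (Fin d)))),
      (∀ v : X, S v =ᵐ[volume.restrict (Ω : Set (EuclideanSpace ℝ (Fin d)))]
        fun x => H1.val σ x • H1.grad (J v) x) ∧
      ∀ v : X, Q v =ᵐ[volume.restrict (Ω : Set (EuclideanSpace ℝ (Fin d)))]
        fun x => H1.val (J v) x • advField b σ x := by
  have hσ : MemLp (H1.val σ) ⊤ (volume.restrict (Ω : Set (EuclideanSpace ℝ (Fin d)))) :=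
    memLp_top_of_bound (H1.memLp_val σ).1 _ (ae_bound_of_mulOp hJt hT)
  let G := (H1.gradL Ω).comp J
  let V := (H1.valL Ω).comp J
  let B : ℝ →L[ℝ] EuclideanSpace ℝ (Fin d) →L[ℝ] EuclideanSpace ℝ (Fin d) :=
    ContinuousLinearMap.lsmul ℝ ℝ
  let S := (B.holderL (volume.restrict (Ω : Set (EuclideanSpace ℝ (Fin d)))) ⊤ 2 2
    (hσ.toLp _)).comp G
  let P := (B.flip.holderL (volume.restrict (Ω : Set (EuclideanSpace ℝ (Fin d)))) ⊤ 2 2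
    (hb.toLp _)).comp (V.comp T)
  have hS : ∀ v : X, S v =ᵐ[volume.restrict (Ω : Set (EuclideanSpace ℝ (Fin d)))]
      fun x => H1.val σ x • H1.grad (J v) x := by
    intro v
    filter_upwards [B.coeFn_holder (r := 2) (hσ.toLp _) (G v), hσ.coeFn_toLp] with x h1 h2
    refine h1.trans ?_
    rw [h2]
    rfl
  have hP : ∀ v : X, P v =ᵐ[volume.restrict (Ω : Set (EuclideanSpace ℝ (Fin d)))]
      fun x => (H1.val σ x * H1.val (J v) x) • b x := by
    intro v
    filter_upwards [B.flip.coeFn_holder (r := 2) (hb.toLp _) (V (T v)), hb.coeFn_toLp, hT v]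
      with x h1 h2 h3
    refine h1.trans ?_
    rw [h2, ← h3]
    rfl
  -- `vB = v∇σ + σvb`, where `v∇σ = ∇(σv) - σ∇v` is the part not visibly in `L²`.
  refine ⟨S, G.comp T - S + P, hS, fun v => ?_⟩
  -- A priori `v∇σ` is only a product of two `L²` functions, hence in `L¹`; this is why weak
  -- gradients are compared under local integrability.
  have hloc : LocallyIntegrable
      (fun x => H1.val σ x • H1.grad (J v) x + H1.val (J v) x • H1.grad σ x)
      (volume.restrict (Ω : Set (EuclideanSpace ℝ (Fin d)))) :=
    (memLp_one_iff_integrable.1 ((H1.memLp_grad (J v)).smul (H1.memLp_val σ))).add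
      (memLp_one_iff_integrable.1 ((H1.memLp_grad σ).smul (H1.memLp_val (J v))))
      |>.locallyIntegrable
  have hgrad := ((H1.isWeakGradient (J (T v))).congr (hT v) (EventuallyEq.refl _ _)).ae_eq
    (isWeakGradient_mul σ (hJ v)) ((H1.memLp_grad _).locallyIntegrable (by norm_num)) hloc
  filter_upwards [Lp.coeFn_add ((G.comp T - S) v) (P v), Lp.coeFn_sub (G (T v)) (S v), hS v, hP v,
    hgrad] with x h1 h2 h3 h4 h5
  have h6 : G (T v) x = H1.grad (J (T v)) x := rfl
  refine h1.trans ?_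
  rw [Pi.add_apply, h4]
  refine (congrArg (· + _) h2).trans ?_
  rw [Pi.sub_apply, h3, h6, h5, advField]
  module

end Banach

/-! ### Coercivity and Galerkin well-posedness -/

/-- Solvability of coercive variational problems. -/
lemma existsUnique_of_coercive {V : Type*} [NormedAddCommGroup V] [InnerProductSpace ℝ V]
    [CompleteSpace V] (B : V →L[ℝ] V →L[ℝ] ℝ) {c : ℝ} (hc : 0 < c)
    (hB : ∀ u, c * ‖u‖ ^ 2 ≤ B u u) (G : StrongDual ℝ V) : ∃! u, ∀ v, B u v = G v := by
  have hco : IsCoercive B := ⟨c, hc, fun u => by simpa [sq, mul_assoc] using hB u⟩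
  refine ⟨hco.continuousLinearEquivOfBilin.symm ((InnerProductSpace.toDual ℝ V).symm G),
    fun v => ?_, fun u hu => ?_⟩
  · rw [← hco.continuousLinearEquivOfBilin_apply, ContinuousLinearEquiv.apply_symm_apply,
      InnerProductSpace.toDual_symm_apply]
  · rw [ContinuousLinearEquiv.eq_symm_apply]
    refine (InnerProductSpace.toDual ℝ V).injective ?_
    ext v
    rw [InnerProductSpace.toDual_apply_apply, hco.continuousLinearEquivOfBilin_apply, hu]
    simp

section Hilbert

variable {X : Type*} [NormedAddCommGroup X] [InnerProductSpace ℝ X]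

/-- Applied with `S u = σ∇u`, `Q u = uB` and `G u = ∇u`, this is the form `a_ss`. -/
lemma exists_skew_form {Y : Type*} [NormedAddCommGroup Y] [InnerProductSpace ℝ Y]
    (S Q G : X →L[ℝ] Y) :
    ∃ A : X →L[ℝ] X →L[ℝ] ℝ, ∀ u v : X, A u v =
      inner ℝ (S u) (G v) + (1 / 2 : ℝ) * (inner ℝ (Q v) (G u) - inner ℝ (Q u) (G v)) := by
  let I : Y →L[ℝ] Y →L[ℝ] ℝ := innerSL ℝ
  exact ⟨I.bilinearComp S G + (1 / 2 : ℝ) • ((I.bilinearComp Q G).flip - I.bilinearComp Q G),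
    fun u v => rfl⟩

set_option maxHeartbeats 1000000 in
/-- The skew-symmetric form is given by an absolutely convergent integral, and is bilinear and
bounded. -/
lemma exists_form {b : EuclideanSpace ℝ (Fin d) → EuclideanSpace ℝ (Fin d)}
    (hb : MemLp b ⊤ (volume.restrict (Ω : Set (EuclideanSpace ℝ (Fin d)))))
    {J : X →L[ℝ] H1 Ω} (hJ : ∀ v, J v ∈ H10 Ω) (hJt : ∀ φ : 𝓓(Ω, ℝ), testH1 φ ∈ Set.range J)
    {σ : H1 Ω} {T : X →L[ℝ] X} (hT : ∀ v : X, IsProduct σ (J v) (J (T v))) :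
    (∀ u v : X, Integrable (aSSIntegrand b σ (J u) (J v))
      (volume.restrict (Ω : Set (EuclideanSpace ℝ (Fin d))))) ∧
    ∃ A : X →L[ℝ] X →L[ℝ] ℝ, ∀ u v : X, A u v = aSS b σ (J u) (J v) := by
  obtain ⟨S, Q, hS, hQ⟩ := exists_coefficient_ops hb hJ hJt hT
  let G := (H1.gradL Ω).comp J
  have hae : ∀ u v : X, (fun x => inner ℝ (S u x) (G v x) +
      (1 / 2 : ℝ) * (inner ℝ (Q v x) (G u x) - inner ℝ (Q u x) (G v x)))
      =ᵐ[volume.restrict (Ω : Set (EuclideanSpace ℝ (Fin d)))] aSSIntegrand b σ (J u) (J v) := by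
    intro u v
    filter_upwards [hS u, hQ u, hQ v] with x h1 h2 h3
    have e1 : G u x = H1.grad (J u) x := rfl
    have e2 : G v x = H1.grad (J v) x := rfl
    rw [h1, h2, h3, e1, e2]
    simp only [aSSIntegrand, real_inner_smul_left, real_inner_smul_right, inner_sub_right]
  have hi : ∀ p q : Lp (EuclideanSpace ℝ (Fin d)) 2
      (volume.restrict (Ω : Set (EuclideanSpace ℝ (Fin d)))),
      Integrable (fun x => inner ℝ (p x) (q x))
        (volume.restrict (Ω : Set (EuclideanSpace ℝ (Fin d)))) :=
    fun p q => L2.integrable_inner p q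
  refine ⟨fun u v => ((hi _ _).add (((hi _ _).sub (hi _ _)).const_mul _)).congr (hae u v), ?_⟩
  obtain ⟨A, hA⟩ := exists_skew_form S Q G
  refine ⟨A, fun u v => ?_⟩
  rw [hA, aSS, ← integral_congr_ae (hae u v),
    integral_add (hi _ _) (Integrable.const_mul (f := fun x =>
      inner ℝ (Q v x) (G u x) - inner ℝ (Q u x) (G v x)) ((hi _ _).sub (hi _ _)) _),
    integral_const_mul,
    integral_sub (hi _ _) (hi _ _), ← L2.inner_def, ← L2.inner_def, ← L2.inner_def]

/-- The skew-symmetric form is bounded below by the Dirichlet form. -/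
lemma essInf_mul_le_aSS {b : EuclideanSpace ℝ (Fin d) → EuclideanSpace ℝ (Fin d)} {σ u : H1 Ω}
    (hσ : 0 < essInf (H1.val σ) (volume.restrict (Ω : Set (EuclideanSpace ℝ (Fin d)))))
    (hi : Integrable (aSSIntegrand b σ u u)
      (volume.restrict (Ω : Set (EuclideanSpace ℝ (Fin d))))) :
    essInf (H1.val σ) (volume.restrict (Ω : Set (EuclideanSpace ℝ (Fin d)))) *
      ‖H1.gradL Ω u‖ ^ 2 ≤ aSS b σ u u := by
  rw [norm_sq_eq_integral, ← integral_const_mul, aSS]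
  refine integral_mono_ae ((Lp.memLp (H1.gradL Ω u)).norm.integrable_sq.const_mul _) hi ?_
  filter_upwards [ae_essInf_le_of_pos hσ] with x hx
  -- The skew part cancels pointwise on the diagonal.
  rw [H1.coe_gradL, aSSIntegrand, sub_self, smul_zero, inner_zero_right, add_zero,
    real_inner_self_eq_norm_sq]
  gcongr

/-- Well-posedness of Galerkin discretizations of a coercive problem with right-hand side
`v ↦ F (T v)`. -/
lemma galerkin [CompleteSpace X] (A : X →L[ℝ] X →L[ℝ] ℝ) {c : ℝ} (hc : 0 < c)
    (hA : ∀ u, c * ‖u‖ ^ 2 ≤ A u u) (T : X →L[ℝ] X) (U : Submodule ℝ X)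
    (hU : IsClosed (U : Set X)) (F : StrongDual ℝ X) :
    (∃! u, u ∈ U ∧ ∀ v ∈ U, A u v = F (T v)) ∧
      ∀ u, (u ∈ U ∧ ∀ v ∈ U, A u v = F (T v)) → ‖u‖ ≤ ‖T‖ / c * ‖F‖ := by
  have : CompleteSpace U := hU.completeSpace_coe
  constructor
  · obtain ⟨u, hu, hu'⟩ := existsUnique_of_coercive (A.bilinearComp U.subtypeL U.subtypeL) hc
      (fun u => hA u) ((F.comp T).comp U.subtypeL)
    refine ⟨u, ⟨u.2, fun v hv => hu ⟨v, hv⟩⟩, fun w hw => ?_⟩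
    exact congrArg Subtype.val (hu' ⟨w, hw.1⟩ fun v => hw.2 v v.2)
  · rintro u ⟨hu, h⟩
    rcases (norm_nonneg u).eq_or_lt with h0 | h0
    · rw [← h0]
      positivity
    -- Test with `v = u`, then cancel one factor `‖u‖`.
    · have h1 : c * ‖u‖ ^ 2 ≤ ‖F‖ * (‖T‖ * ‖u‖) :=
        calc c * ‖u‖ ^ 2 ≤ F (T u) := (hA u).trans_eq (h u hu)
          _ ≤ ‖F (T u)‖ := Real.le_norm_self _
          _ ≤ ‖F‖ * ‖T u‖ := F.le_opNorm _
          _ ≤ ‖F‖ * (‖T‖ * ‖u‖) := by gcongr; exact T.le_opNorm u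
      rw [div_mul_eq_mul_div, le_div_iff₀ hc]
      refine le_of_mul_le_mul_right ?_ h0
      linarith

set_option maxHeartbeats 1000000 in
/-- Well-posedness of the skew-symmetric scheme, with `H¹₀(Ω)` presented as a Hilbert space `X`
isometrically included in `H¹(Ω)`. -/
theorem wellPosed_of_isometry [CompleteSpace X] (i : Fin d)
    (hΩ : Bornology.IsBounded (Ω : Set (EuclideanSpace ℝ (Fin d)))) (J : X →L[ℝ] H1 Ω)
    (hJn : ∀ v, ‖J v‖ = ‖v‖) (hJ : ∀ v, J v ∈ H10 Ω)
    (hJt : ∀ φ : 𝓓(Ω, ℝ), testH1 φ ∈ Set.range J) :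
    ∃ C : ℝ, 0 < C ∧
      ∀ (b : EuclideanSpace ℝ (Fin d) → EuclideanSpace ℝ (Fin d))
        (_ : MemLp b ⊤ (volume.restrict (Ω : Set (EuclideanSpace ℝ (Fin d))))) (σ : H1 Ω)
        (_ : 0 < essInf (H1.val σ) (volume.restrict (Ω : Set (EuclideanSpace ℝ (Fin d)))))
        (_ : ∀ v : X, ∃ w : X, IsProduct σ (J v) (J w)),
        (∀ u v : X, Integrable (aSSIntegrand b σ (J u) (J v))
          (volume.restrict (Ω : Set (EuclideanSpace ℝ (Fin d))))) ∧
        (∃ A : X →L[ℝ] X →L[ℝ] ℝ, ∀ u v : X, A u v = aSS b σ (J u) (J v)) ∧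
        (∀ u : X, C * essInf (H1.val σ)
            (volume.restrict (Ω : Set (EuclideanSpace ℝ (Fin d)))) * ‖u‖ ^ 2 ≤
          aSS b σ (J u) (J u)) ∧
        ∃ M : ℝ, ∀ U : Submodule ℝ X, IsClosed (U : Set X) → ∀ F : StrongDual ℝ X,
          (∃! u : X, u ∈ U ∧ ∀ v ∈ U, ∃ w : X, IsProduct σ (J v) (J w) ∧
            aSS b σ (J u) (J v) = F w) ∧
          ∀ u : X, (u ∈ U ∧ ∀ v ∈ U, ∃ w : X, IsProduct σ (J v) (J w) ∧
            aSS b σ (J u) (J v) = F w) → ‖u‖ ≤ M * ‖F‖ := by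
  obtain ⟨R, hR⟩ := hΩ.exists_norm_le
  have hR0 : 0 < 4 * R ^ 2 + 1 := by positivity
  have hJi : Function.Injective J := (injective_iff_map_eq_zero J).2 fun v hv => by
    rw [← norm_eq_zero, ← hJn, hv, norm_zero]
  -- By Poincaré, `‖u‖² ≤ (4R² + 1)‖∇u‖²`.
  refine ⟨(4 * R ^ 2 + 1)⁻¹, by positivity, fun b hb σ hσ hmul => ?_⟩
  obtain ⟨T, hT⟩ := exists_mulOp hJi hmul
  obtain ⟨hint, A, hA⟩ := exists_form hb hJ hJt hT
  have hco : ∀ u : X, (4 * R ^ 2 + 1)⁻¹ * essInf (H1.val σ)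
      (volume.restrict (Ω : Set (EuclideanSpace ℝ (Fin d)))) * ‖u‖ ^ 2 ≤
        aSS b σ (J u) (J u) := by
    intro u
    refine le_trans ?_ (essInf_mul_le_aSS hσ (hint u u))
    have h1 := poincare i hR (hJ u)
    rw [mul_comm (4 * R ^ 2 + 1)⁻¹, mul_assoc]
    gcongr
    rw [inv_mul_le_iff₀ hR0, ← hJn, H1.norm_sq_eq]
    linarith
  refine ⟨hint, ⟨A, hA⟩, hco, ‖T‖ / ((4 * R ^ 2 + 1)⁻¹ * essInf (H1.val σ)
    (volume.restrict (Ω : Set (EuclideanSpace ℝ (Fin d))))), fun U hU F => ?_⟩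
  -- The representative `w` of `σv` is unique, so it is `T v` and the existential collapses to `F (T
  -- v)`.
  have hiff : ∀ u, (u ∈ U ∧ ∀ v ∈ U, ∃ w : X, IsProduct σ (J v) (J w) ∧
      aSS b σ (J u) (J v) = F w) ↔ (u ∈ U ∧ ∀ v ∈ U, A u v = F (T v)) := by
    refine fun u => and_congr_right fun _ => forall₂_congr fun v _ => ?_
    rw [hA]
    refine ⟨?_, fun h => ⟨T v, hT v, h⟩⟩
    rintro ⟨w, hw, h⟩
    rwa [← hJi (hw.unique (hT v))]
  simp only [hiff]
  exact galerkin A (by positivity) (fun u => (hco u).trans_eq (hA u u).symm) T U hU F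

end Hilbert

end SkewGalerkin

theorem proposition3p1 (d : ℕ) (hd : 2 ≤ d) (Ω : Opens (EuclideanSpace ℝ (Fin d)))
    (hΩ : Bornology.IsBounded (Ω : Set (EuclideanSpace ℝ (Fin d)))) :
    ∃ C : ℝ, 0 < C ∧
      ∀ (b : EuclideanSpace ℝ (Fin d) → EuclideanSpace ℝ (Fin d))
        (_ : MemLp b ⊤ (volume.restrict (Ω : Set (EuclideanSpace ℝ (Fin d)))))
        (σ : SkewGalerkin.H1 Ω)
        (_ : 0 < essInf (SkewGalerkin.H1.val σ)
          (volume.restrict (Ω : Set (EuclideanSpace ℝ (Fin d)))))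
        (_ : ∀ v : SkewGalerkin.H10 Ω, ∃ w : SkewGalerkin.H10 Ω,
          SkewGalerkin.IsProduct σ (v : SkewGalerkin.H1 Ω) (w : SkewGalerkin.H1 Ω)),
        -- the integral defining the form converges on `H¹₀(Ω)`
        (∀ u v : SkewGalerkin.H10 Ω,
          Integrable (SkewGalerkin.aSSIntegrand b σ (u : SkewGalerkin.H1 Ω)
            (v : SkewGalerkin.H1 Ω))
            (volume.restrict (Ω : Set (EuclideanSpace ℝ (Fin d))))) ∧
        -- the form is bilinear and bounded on `H¹₀(Ω)`
        (∃ A : SkewGalerkin.H10 Ω →L[ℝ] SkewGalerkin.H10 Ω →L[ℝ] ℝ,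
          ∀ u v : SkewGalerkin.H10 Ω,
            A u v = SkewGalerkin.aSS b σ (u : SkewGalerkin.H1 Ω) (v : SkewGalerkin.H1 Ω)) ∧
        -- the form is coercive on `H¹₀(Ω)`
        (∀ u : SkewGalerkin.H10 Ω,
          C * essInf (SkewGalerkin.H1.val σ)
              (volume.restrict (Ω : Set (EuclideanSpace ℝ (Fin d)))) * ‖u‖ ^ 2 ≤
            SkewGalerkin.aSS b σ (u : SkewGalerkin.H1 Ω) (u : SkewGalerkin.H1 Ω)) ∧
        -- the discrete problem is well-posed, uniformly in the discretization space `U`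
        (∃ M : ℝ, ∀ U : Submodule ℝ (SkewGalerkin.H10 Ω),
          IsClosed (U : Set (SkewGalerkin.H10 Ω)) →
            ∀ F : StrongDual ℝ (SkewGalerkin.H10 Ω),
              (∃! u : SkewGalerkin.H10 Ω, SkewGalerkin.IsDiscreteSolution b σ U F u) ∧
              ∀ u : SkewGalerkin.H10 Ω, SkewGalerkin.IsDiscreteSolution b σ U F u →
                ‖u‖ ≤ M * ‖F‖) := by
  -- The index `0` is the coordinate direction used in the Poincaré inequality.
  exact @SkewGalerkin.wellPosed_of_isometry d Ω (SkewGalerkin.H10 Ω) inferInstance inferInstance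
    inferInstance ⟨0, by omega⟩ hΩ (SkewGalerkin.H10 Ω).subtypeL (fun _ => rfl) (fun v => v.2)
    (fun φ => ⟨⟨_, SkewGalerkin.testH1_mem_H10 φ⟩, rfl⟩)

end
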